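/- Let $A$ and $B$ be complex unital Banach algebras, and let $A$ be semisimple (its Jacobson radical is zero). Let $T\colon A\to B$ be a surjective additive map which preserves the spectrum, that is, $T(x+y)=Tx+Ty$ for all $x,y\in A$ and $\sigma(Tx)=\sigma(x)$ for every $x\in A$. Then $T$ maps idempotents in $A$ to idempotents in $B$: if $e\in A$ satisfies $e^2=e$, then $(Te)^2=Te$. -/

import Mathlib

/-!
Write `f = T e`, so that `σ(f) = σ(e) ⊆ {0, 1}`. Lifting idempotents gives an idempotent `p` commuting
with `f` such that `f - p` is quasinilpotent (`exists_isIdempotentElem_commute`), and the point is to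
show that the quasinilpotent `n = f (1 - p)` vanishes; the other half follows by applying this to
`1 - e`, as `T 1 = 1`.

Since `e` is idempotent, `σ(m e + x)` stays within a distance of `{0, m}` that depends on `x` but not on
the natural number `m`. Every `y` in `B` is some `T x`, and `T (m e + x) = m f + y`, so the same holds
for `σ(m f + y)`. For `y` in the corner `(1 - p) B (1 - p)` this makes the spectral radius of `m n + y`
bounded in `m` (`mul_one_sub_eq_zero_of_forall_spectrum`). As `T` is merely additive, nothing is known
about nonreal or even irrational multiples of `n`, nor about the dependence of the bound on `y`.
Nevertheless, on the circle `|μ| = m` the element `μ n + y` is a unimodular multiple of `m n + z y` with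
`|z| = 1`, and dominated convergence in `z` shows that the mean of `log⁺ r(μ n + y)` over the circle is
`o(log m)`. The map `μ ↦ log r(μ n + y)` is subharmonic, so a Liouville argument applies: if `y` is
quasinilpotent then so is `n + y` (`toReal_spectralRadius_add_eq_zero`). Subharmonicity enters through
the bound of the coefficients of `(μ n + y) ^ k` by the Mahler measure
(`norm_coeff_le_two_pow_mul_exp_circleAverage`).

By Zemánek's characterization of the radical
(`mem_jacobson_of_forall_toReal_spectralRadius_add_eq_zero`), `n` then lies in the radical of `B`. The
same characterization transfers semisimplicity from `A` to `B` and gives `T 1 = 1`. Hence `n = 0`.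
-/

open Filter Topology Real

/-! ### Coefficients of vector-valued polynomials -/

/-- A Cauchy estimate with the geometric mean in place of the maximum. For scalar polynomials it is
the bound of the coefficients by the Mahler measure; a norming functional reduces to that case. -/
theorem norm_coeff_le_two_pow_mul_exp_circleAverage {E : Type*} [NormedAddCommGroup E]
    [NormedSpace ℂ E] (d : ℕ) (c : ℕ → E) {j : ℕ} (hj : j ≤ d) :
    ‖c j‖ ≤ 2 ^ d * exp (circleAverage
      (fun ζ => log⁺ ‖∑ i ∈ Finset.range (d + 1), ζ ^ i • c i‖) 0 1) := by
  obtain ⟨φ, hφ, hφj⟩ := exists_dual_vector'' ℂ (c j)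
  set q : Polynomial ℂ := ∑ i ∈ Finset.range (d + 1), Polynomial.monomial i (φ (c i)) with hq
  have hcoeff : q.coeff j = φ (c j) := by
    simp [hq, Polynomial.finsetSum_coeff, Polynomial.coeff_monomial]
    intro h; omega
  have heval : ∀ ζ, q.eval ζ = φ (∑ i ∈ Finset.range (d + 1), ζ ^ i • c i) := by
    intro ζ
    simp [hq, Polynomial.eval_finsetSum, map_sum, mul_comm]
  have hle : ∀ ζ, ‖q.eval ζ‖ ≤ ‖∑ i ∈ Finset.range (d + 1), ζ ^ i • c i‖ := by
    intro ζ
    rw [heval]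
    exact (φ.le_opNorm _).trans (mul_le_of_le_one_left (norm_nonneg _) hφ)
  have hdeg : q.natDegree ≤ d := by
    refine Polynomial.natDegree_sum_le_of_forall_le _ _ fun i hi => ?_
    refine (Polynomial.natDegree_monomial_le _).trans ?_
    simp at hi; omega
  have hmeas : q.mahlerMeasure ≤ exp (circleAverage
      (fun ζ => log⁺ ‖∑ i ∈ Finset.range (d + 1), ζ ^ i • c i‖) 0 1) := by
    by_cases h0 : q = 0
    · simp [h0, exp_nonneg]
    rw [Polynomial.mahlerMeasure, if_pos h0, exp_le_exp, Polynomial.logMahlerMeasure_def]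
    refine circleAverage_mono q.intervalIntegrable_mahlerMeasure ?_ fun ζ _ => ?_
    · apply ContinuousOn.circleIntegrable zero_le_one
      fun_prop
    · exact (le_max_right _ _).trans (posLog_le_posLog (norm_nonneg _) (hle ζ))
  have h1 := Polynomial.norm_coeff_le_choose_mul_mahlerMeasure j q
  rw [hcoeff, hφj] at h1
  simp only [RCLike.norm_ofReal, abs_norm] at h1
  refine h1.trans (mul_le_mul ?_ hmeas (Polynomial.mahlerMeasure_nonneg q) (by positivity))
  calc ((q.natDegree.choose j : ℕ) : ℝ) ≤ ((2 ^ q.natDegree : ℕ) : ℝ) := by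
        exact_mod_cast Nat.choose_le_two_pow _ _
    _ ≤ 2 ^ d := by
        push_cast
        exact pow_le_pow_right₀ (by norm_num) hdeg

/-- The maximum version, deduced by rescaling so that `log⁺` vanishes on the circle. -/
theorem norm_coeff_le_two_pow_mul_of_norm_le {E : Type*} [NormedAddCommGroup E]
    [NormedSpace ℂ E] (d : ℕ) (c : ℕ → E) {M : ℝ} (hM : 0 < M)
    (h : ∀ ζ : ℂ, ‖ζ‖ = 1 → ‖∑ i ∈ Finset.range (d + 1), ζ ^ i • c i‖ ≤ M)
    {j : ℕ} (hj : j ≤ d) : ‖c j‖ ≤ 2 ^ d * M := by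
  have key := norm_coeff_le_two_pow_mul_exp_circleAverage d (fun i => ((M⁻¹ : ℝ) : ℂ) • c i) hj
  have hav : circleAverage
      (fun ζ => log⁺ ‖∑ i ∈ Finset.range (d + 1), ζ ^ i • ((M⁻¹ : ℝ) : ℂ) • c i‖) 0 1 = 0 := by
    rw [circleAverage_congr_sphere (f₂ := fun _ => (0 : ℝ)), circleAverage_const]
    intro ζ hζ
    have hζ1 : ‖ζ‖ = 1 := by simpa using hζ
    simp only
    rw [posLog_eq_zero_iff, abs_norm]
    have : ∑ i ∈ Finset.range (d + 1), ζ ^ i • ((M⁻¹ : ℝ) : ℂ) • c i =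
        ((M⁻¹ : ℝ) : ℂ) • ∑ i ∈ Finset.range (d + 1), ζ ^ i • c i := by
      rw [Finset.smul_sum]
      exact Finset.sum_congr rfl fun i _ => smul_comm _ _ _
    rw [this, norm_smul, Complex.norm_real, norm_inv, norm_of_nonneg hM.le]
    rw [inv_mul_le_iff₀ hM, mul_one]
    exact h ζ hζ1
  rw [hav, exp_zero, mul_one, norm_smul, Complex.norm_real, norm_inv, norm_of_nonneg hM.le,
    inv_mul_le_iff₀ hM] at key
  linarith

/-- The powers of `μ • a + b` are polynomials in `μ` with coefficients in `B`, although `a` and `b`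
need not commute. -/
theorem exists_pow_smul_add_eq_sum {B : Type*} [Ring B] [Algebra ℂ B] (a b : B) (k : ℕ) :
    ∃ c : ℕ → B, ∀ μ : ℂ, (μ • a + b) ^ k = ∑ i ∈ Finset.range (k + 1), μ ^ i • c i := by
  induction k with
  | zero => exact ⟨fun _ => 1, fun μ => by simp⟩
  | succ k ih =>
    obtain ⟨c, hc⟩ := ih
    refine ⟨fun i => (if i ≤ k then c i * b else 0) + (if i = 0 then 0 else c (i - 1) * a),
      fun μ => ?_⟩
    have h1 : ∑ i ∈ Finset.range (k + 1 + 1), μ ^ i • (if i ≤ k then c i * b else 0) =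
        ∑ i ∈ Finset.range (k + 1), μ ^ i • (c i * b) := by
      rw [Finset.sum_range_succ]
      simp only [show ¬ (k + 1 ≤ k) by omega, if_false, smul_zero, add_zero]
      refine Finset.sum_congr rfl fun i hi => ?_
      rw [if_pos (by simp at hi; omega)]
    have h2 : ∑ i ∈ Finset.range (k + 1 + 1), μ ^ i • (if i = 0 then 0 else c (i - 1) * a) =
        ∑ i ∈ Finset.range (k + 1), μ ^ (i + 1) • (c i * a) := by
      rw [Finset.sum_range_succ']
      simp
    simp only [smul_add, Finset.sum_add_distrib]
    rw [h1, h2, pow_succ, hc, mul_add, Finset.sum_mul, Finset.sum_mul, add_comm]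
    congr 1
    · refine Finset.sum_congr rfl fun i _ => by rw [smul_mul_assoc]
    · refine Finset.sum_congr rfl fun i _ => by
        rw [smul_mul_assoc, mul_smul_comm, smul_smul, pow_succ]

section

/-! ### The spectral radius as a real-valued function -/

variable {B : Type*} [NormedRing B]

theorem norm_pow_le_norm_one_add_one_mul (x : B) (k : ℕ) :
    ‖x ^ k‖ ≤ (‖(1 : B)‖ + 1) * ‖x‖ ^ k := by
  rcases Nat.eq_zero_or_pos k with rfl | hk
  · simp
  · refine (norm_pow_le' x hk).trans (le_mul_of_one_le_left (by positivity) ?_)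
    linarith [norm_nonneg (1 : B)]

theorem norm_pow_rpow_le (x : B) {k : ℕ} (hk : k ≠ 0) : ‖x ^ k‖ ^ (1 / k : ℝ) ≤ ‖x‖ := by
  calc ‖x ^ k‖ ^ (1 / k : ℝ) ≤ (‖x‖ ^ k) ^ (1 / k : ℝ) := by
        gcongr
        exact norm_pow_le' x (Nat.pos_of_ne_zero hk)
    _ = ‖x‖ := by
        rw [one_div, pow_rpow_inv_natCast (norm_nonneg _) hk]

variable [NormedAlgebra ℂ B]

theorem toReal_spectralRadius_le {x : B} {K : ℝ} (hK : 0 ≤ K)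
    (h : ∀ z ∈ spectrum ℂ x, ‖z‖ ≤ K) : (spectralRadius ℂ x).toReal ≤ K := by
  refine ENNReal.toReal_le_of_le_ofReal hK (iSup₂_le fun z hz => ?_)
  rw [← enorm_eq_nnnorm, ← ofReal_norm]
  exact ENNReal.ofReal_le_ofReal (h z hz)

variable [CompleteSpace B]

theorem spectralRadius_ne_top (x : B) : spectralRadius ℂ x ≠ ⊤ := by
  have h := spectrum.spectralRadius_le_pow_nnnorm_pow_one_div ℂ x 0
  refine ne_top_of_le_ne_top ?_ h
  simp [ENNReal.mul_eq_top]

theorem tendsto_norm_pow_rpow_toReal_spectralRadius (x : B) :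
    Tendsto (fun k : ℕ => ‖x ^ k‖ ^ (1 / k : ℝ)) atTop (𝓝 (spectralRadius ℂ x).toReal) := by
  have h := spectrum.pow_norm_pow_one_div_tendsto_nhds_spectralRadius x
  have h2 := (ENNReal.tendsto_toReal (spectralRadius_ne_top x)).comp h
  refine h2.congr fun k => ?_
  simp only [Function.comp]
  rw [ENNReal.toReal_ofReal (by positivity)]

theorem toReal_spectralRadius_le_norm (x : B) : (spectralRadius ℂ x).toReal ≤ ‖x‖ := by
  refine le_of_tendsto (tendsto_norm_pow_rpow_toReal_spectralRadius x) ?_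
  filter_upwards [eventually_ne_atTop 0] with k hk using norm_pow_rpow_le x hk

theorem norm_le_toReal_spectralRadius {x : B} {z : ℂ} (hz : z ∈ spectrum ℂ x) :
    ‖z‖ ≤ (spectralRadius ℂ x).toReal := by
  have h : (‖z‖₊ : ENNReal) ≤ spectralRadius ℂ x := le_iSup₂ (α := ENNReal) z hz
  simpa using ENNReal.toReal_mono (spectralRadius_ne_top x) h

theorem eventually_norm_pow_le_of_toReal_spectralRadius_lt {x : B} {δ : ℝ}
    (h : (spectralRadius ℂ x).toReal < δ) : ∀ᶠ k : ℕ in atTop, ‖x ^ k‖ ≤ δ ^ k := by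
  filter_upwards [(tendsto_norm_pow_rpow_toReal_spectralRadius x).eventually_lt_const h,
    eventually_ne_atTop 0] with k hk hk0
  calc ‖x ^ k‖ = (‖x ^ k‖ ^ (1 / k : ℝ)) ^ k := by
        rw [one_div, rpow_inv_natCast_pow (norm_nonneg _) hk0]
    _ ≤ δ ^ k := by gcongr

theorem toReal_spectralRadius_le_of_eventually_norm_pow_le {x : B} {C δ : ℝ} (hC : 0 < C)
    (hδ : 0 ≤ δ) (h : ∀ᶠ k : ℕ in atTop, ‖x ^ k‖ ≤ C * δ ^ k) :
    (spectralRadius ℂ x).toReal ≤ δ := by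
  have h1 : Tendsto (fun k : ℕ => C ^ (1 / k : ℝ) * δ) atTop (𝓝 (C ^ (0 : ℝ) * δ)) := by
    refine Tendsto.mul_const δ ?_
    exact (tendsto_const_nhds.rpow tendsto_one_div_atTop_nhds_zero_nat (Or.inl hC.ne'))
  rw [rpow_zero, one_mul] at h1
  refine le_of_tendsto_of_tendsto (tendsto_norm_pow_rpow_toReal_spectralRadius x) h1 ?_
  filter_upwards [h, eventually_ne_atTop 0] with k hk hk0
  calc ‖x ^ k‖ ^ (1 / k : ℝ) ≤ (C * δ ^ k) ^ (1 / k : ℝ) := by gcongr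
    _ = C ^ (1 / k : ℝ) * δ := by
      rw [mul_rpow hC.le (by positivity), one_div, pow_rpow_inv_natCast hδ hk0]

/-- Gelfand's formula, integrated over the unit circle by dominated convergence. -/
theorem tendsto_circleAverage_posLog_norm_pow (a b : B) :
    Tendsto (fun k : ℕ => circleAverage (fun ζ => log⁺ (‖(ζ • a + b) ^ k‖ ^ (1 / k : ℝ))) 0 1) atTop
      (𝓝 (circleAverage (fun ζ => log⁺ (spectralRadius ℂ (ζ • a + b)).toReal) 0 1)) := by
  simp only [circleAverage_def]
  refine Tendsto.const_smul ?_ _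
  refine intervalIntegral.tendsto_integral_filter_of_dominated_convergence
    (fun _ => log⁺ (‖a‖ + ‖b‖)) ?_ ?_ ?_ ?_
  · filter_upwards with k
    refine Continuous.aestronglyMeasurable ?_
    refine continuous_posLog.comp ?_
    refine Continuous.rpow_const (by fun_prop) fun _ => Or.inr (by positivity)
  · filter_upwards [eventually_ne_atTop 0] with k hk
    refine MeasureTheory.ae_of_all _ fun θ _ => ?_
    rw [norm_of_nonneg posLog_nonneg]
    refine posLog_le_posLog (by positivity) ((norm_pow_rpow_le _ hk).trans ?_)
    refine (norm_add_le _ _).trans ?_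
    gcongr
    rw [norm_smul]; simp
  · simp
  · refine MeasureTheory.ae_of_all _ fun θ _ => ?_
    exact (continuous_posLog.tendsto _).comp (tendsto_norm_pow_rpow_toReal_spectralRadius _)

/-- The spectral radius is only upper semicontinuous; measurability comes from Gelfand's formula. -/
theorem measurable_toReal_spectralRadius_comp {X : Type*} [TopologicalSpace X] [MeasurableSpace X]
    [BorelSpace X] {g : X → B} (hg : Continuous g) :
    Measurable fun t => (spectralRadius ℂ (g t)).toReal := by
  refine measurable_of_tendsto_metrizable (f := fun k : ℕ => fun t => ‖(g t) ^ k‖ ^ (1 / k : ℝ))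
    (fun k => ?_) ?_
  · refine Continuous.measurable ?_
    exact Continuous.rpow_const (by fun_prop) fun _ => Or.inr (by positivity)
  · rw [tendsto_pi_nhds]
    exact fun t => tendsto_norm_pow_rpow_toReal_spectralRadius _

/-! ### Logarithmic growth of the spectral radius along affine families -/

theorem toReal_spectralRadius_smul_of_norm_eq_one {ζ : ℂ} (hζ : ‖ζ‖ = 1) (x : B) :
    (spectralRadius ℂ (ζ • x)).toReal = (spectralRadius ℂ x).toReal := by
  refine tendsto_nhds_unique (tendsto_norm_pow_rpow_toReal_spectralRadius (ζ • x)) ?_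
  refine (tendsto_norm_pow_rpow_toReal_spectralRadius x).congr fun k => ?_
  rw [smul_pow, norm_smul, norm_pow ζ, hζ, one_pow, one_mul]

/-- Boundedness of the spectral radius of `m • a + z • b` along the naturals `m`, for each `z` on the
unit circle separately, forces the logarithmic mean of the spectral radius of `μ • a + b` over
`|μ| = m` to be `o(log m)`: with `μ = m ζ`, the element `μ • a + b` is `ζ` times `m • a + ζ⁻¹ • b`.
No uniformity in `z` is needed, because `log m + O(1)` is an integrable majorant. -/
theorem tendsto_circleAverage_posLog_div_log {a b : B}
    (h : ∀ z : ℂ, ‖z‖ = 1 → ∃ K : ℝ, ∀ᶠ m : ℕ in atTop,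
      (spectralRadius ℂ ((m : ℂ) • a + z • b)).toReal ≤ K) :
    Tendsto (fun m : ℕ => circleAverage
      (fun ζ => log⁺ (spectralRadius ℂ (ζ • (m : ℂ) • a + b)).toReal) 0 1 / log m)
      atTop (𝓝 0) := by
  have key : Tendsto (fun m : ℕ => ∫ θ in (0 : ℝ)..2 * π,
      log⁺ (spectralRadius ℂ (circleMap 0 1 θ • (m : ℂ) • a + b)).toReal / log m)
      atTop (𝓝 (∫ _ in (0 : ℝ)..2 * π, (0 : ℝ))) := by
    refine intervalIntegral.tendsto_integral_filter_of_dominated_convergence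
      (fun _ => 1 + log⁺ (‖a‖ + ‖b‖) / log 2) ?_ ?_ ?_ ?_
    · filter_upwards with m
      refine Measurable.aestronglyMeasurable ?_
      refine Measurable.div_const (continuous_posLog.measurable.comp ?_) _
      exact measurable_toReal_spectralRadius_comp (by fun_prop)
    · filter_upwards [eventually_ge_atTop 2] with m hm
      refine MeasureTheory.ae_of_all _ fun θ _ => ?_
      have hm' : (2 : ℝ) ≤ m := by exact_mod_cast hm
      have hl2 : 0 < log 2 := log_pos (by norm_num)
      have hlm : log 2 ≤ log m := log_le_log (by norm_num) hm'
      rw [norm_of_nonneg (div_nonneg posLog_nonneg (hl2.le.trans hlm))]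
      have hn : ‖circleMap 0 1 θ • (m : ℂ) • a + b‖ ≤ m * (‖a‖ + ‖b‖) := by
        refine (norm_add_le _ _).trans ?_
        rw [norm_smul, norm_smul]
        simp only [norm_circleMap_zero, abs_one, one_mul, Complex.norm_natCast]
        nlinarith [norm_nonneg b]
      have h1 : log⁺ (spectralRadius ℂ (circleMap 0 1 θ • (m : ℂ) • a + b)).toReal ≤
          log m + log⁺ (‖a‖ + ‖b‖) :=
        (posLog_le_posLog ENNReal.toReal_nonneg
          ((toReal_spectralRadius_le_norm _).trans hn)).trans posLog_nat_mul
      rw [div_le_iff₀ (by linarith), add_mul, one_mul]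
      refine h1.trans ?_
      gcongr
      rw [div_mul_eq_mul_div, le_div_iff₀ hl2]
      exact mul_le_mul_of_nonneg_left hlm posLog_nonneg
    · simp
    · refine MeasureTheory.ae_of_all _ fun θ _ => ?_
      set ζ := circleMap 0 1 θ with hζ
      have hζ1 : ‖ζ‖ = 1 := by simp [hζ]
      have hζ0 : ζ ≠ 0 := by intro h0; simp [h0] at hζ1
      obtain ⟨K, hK⟩ := h ζ⁻¹ (by simp [hζ1])
      have hlim : Tendsto (fun m : ℕ => log⁺ K / log m) atTop (𝓝 0) :=
        (tendsto_log_atTop.comp tendsto_natCast_atTop_atTop).const_div_atTop _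
      refine squeeze_zero' ?_ ?_ hlim
      · filter_upwards with m using div_nonneg posLog_nonneg (log_natCast_nonneg m)
      · filter_upwards [hK] with m hm
        have : ζ • (m : ℂ) • a + b = ζ • ((m : ℂ) • a + ζ⁻¹ • b) := by
          rw [smul_add, smul_smul ζ ζ⁻¹, mul_inv_cancel₀ hζ0, one_smul]
        rw [this, toReal_spectralRadius_smul_of_norm_eq_one hζ1]
        exact div_le_div_of_nonneg_right (posLog_le_posLog ENNReal.toReal_nonneg hm)
          (log_natCast_nonneg m)
  have := key.const_smul (2 * π)⁻¹
  simp only [intervalIntegral.integral_zero, smul_zero] at this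
  refine this.congr fun m => ?_
  rw [circleAverage_def, intervalIntegral.integral_div, smul_eq_mul, smul_eq_mul, mul_div_assoc]

theorem eventually_circleAverage_posLog_norm_pow_le {a b : B}
    (h : ∀ z : ℂ, ‖z‖ = 1 → ∃ K : ℝ, ∀ᶠ m : ℕ in atTop,
      (spectralRadius ℂ ((m : ℂ) • a + z • b)).toReal ≤ K) {ε : ℝ} (hε : 0 < ε) :
    ∀ᶠ m : ℕ in atTop, ∀ᶠ k : ℕ in atTop,
      circleAverage (fun ζ => log⁺ ‖(ζ • (m : ℂ) • a + b) ^ k‖) 0 1 ≤ ε * k * log m := by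
  filter_upwards [(tendsto_circleAverage_posLog_div_log h).eventually_lt_const hε,
    eventually_ge_atTop 2] with m hm hm2
  have hlog : 0 < log m := log_pos (by exact_mod_cast (by omega : 1 < m))
  rw [div_lt_iff₀ hlog] at hm
  filter_upwards [(tendsto_circleAverage_posLog_norm_pow ((m : ℂ) • a) b).eventually_lt_const hm,
    eventually_ne_atTop 0] with k hk hk0
  have hpow : ∀ ζ : ℂ, log⁺ ‖(ζ • (m : ℂ) • a + b) ^ k‖ =
      (k : ℝ) • log⁺ (‖(ζ • (m : ℂ) • a + b) ^ k‖ ^ (1 / k : ℝ)) := by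
    intro ζ
    rw [smul_eq_mul, ← posLog_pow, one_div, rpow_inv_natCast_pow (norm_nonneg _) hk0]
  simp only [hpow]
  rw [circleAverage_fun_smul, smul_eq_mul]
  nlinarith [(Nat.cast_nonneg k : (0 : ℝ) ≤ k)]

/-- Uniform upper semicontinuity of the spectral radius at `b`, in terms of powers. -/
theorem exists_forall_norm_pow_le_mul_pow (a : B) {b : B} {δ : ℝ} (hδ : 0 < δ)
    (hb : (spectralRadius ℂ b).toReal < δ) :
    ∃ r : ℝ, 0 < r ∧ r < 1 ∧ ∃ C : ℝ, 0 < C ∧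
      ∀ μ : ℂ, ‖μ‖ ≤ r → ∀ k : ℕ, ‖(μ • a + b) ^ k‖ ≤ C * δ ^ k := by
  obtain ⟨δ', hδ', hδ'δ⟩ := exists_between hb
  obtain ⟨k₀, hk₀, hk0⟩ := ((eventually_norm_pow_le_of_toReal_spectralRadius_lt hδ').and
    (eventually_ne_atTop 0)).exists
  have hδ'0 : 0 ≤ δ' := ENNReal.toReal_nonneg.trans hδ'.le
  have hlt : ‖((0 : ℂ) • a + b) ^ k₀‖ < δ ^ k₀ := by
    rw [zero_smul, zero_add]
    exact hk₀.trans_lt (pow_lt_pow_left₀ hδ'δ hδ'0 hk0)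
  have hcont : Continuous fun μ : ℂ => ‖(μ • a + b) ^ k₀‖ := by fun_prop
  obtain ⟨s, hs, hball⟩ := Metric.eventually_nhds_iff.mp
    (hcont.continuousAt.eventually_lt_const hlt)
  set M := max 1 (‖a‖ + ‖b‖) with hM
  have hM1 : 1 ≤ M := le_max_left _ _
  set N := ‖(1 : B)‖ + 1 with hN
  have hN0 : 0 < N := by positivity
  refine ⟨min (s / 2) (1 / 2), by positivity, by
    exact (min_le_right _ _).trans_lt (by norm_num), N * N * (max 1 (M / δ)) ^ k₀, by positivity,
    fun μ hμ k => ?_⟩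
  have hμs : ‖μ‖ < s := by
    have := hμ.trans (min_le_left _ _)
    linarith
  have hμ1 : ‖μ‖ ≤ 1 := (hμ.trans (min_le_right _ _)).trans (by norm_num)
  set x := μ • a + b with hx
  have hxk : ‖x ^ k₀‖ ≤ δ ^ k₀ := (hball (by simpa using hμs)).le
  have hxM : ‖x‖ ≤ M := by
    refine le_trans ?_ (le_max_right _ _)
    refine (norm_add_le _ _).trans ?_
    rw [norm_smul]
    gcongr
    exact mul_le_of_le_one_left (norm_nonneg _) hμ1
  have hmod : k % k₀ ≤ k₀ := (Nat.mod_lt _ (Nat.pos_of_ne_zero hk0)).le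
  calc ‖x ^ k‖ = ‖(x ^ k₀) ^ (k / k₀) * x ^ (k % k₀)‖ := by
        rw [← pow_mul, ← pow_add, Nat.div_add_mod]
    _ ≤ (N * ‖x ^ k₀‖ ^ (k / k₀)) * (N * ‖x‖ ^ (k % k₀)) :=
        (norm_mul_le _ _).trans (mul_le_mul (norm_pow_le_norm_one_add_one_mul _ _)
          (norm_pow_le_norm_one_add_one_mul _ _) (norm_nonneg _) (by positivity))
    _ ≤ (N * (δ ^ k₀) ^ (k / k₀)) * (N * M ^ (k % k₀)) := by gcongr
    _ = N * N * (M / δ) ^ (k % k₀) * δ ^ k := by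
        have : δ ^ k = (δ ^ k₀) ^ (k / k₀) * δ ^ (k % k₀) := by
          rw [← pow_mul, ← pow_add, Nat.div_add_mod]
        rw [this, div_pow]
        field_simp
    _ ≤ N * N * (max 1 (M / δ)) ^ k₀ * δ ^ k := by
        gcongr
        calc (M / δ) ^ (k % k₀) ≤ (max 1 (M / δ)) ^ (k % k₀) := by
              gcongr; exact le_max_right _ _
          _ ≤ _ := pow_le_pow_right₀ (le_max_left _ _) hmod

/-- A Liouville theorem for the spectral radius of `μ • a + b`. Expand `(μ • a + b) ^ k` in powers of
`μ`. The coefficients of index at most `2 η k` are small by the estimate on a small circle, where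
`b` dominates; the others are small by the logarithmic mean over a large circle of radius `m`, which
is at most `m ^ (η k)`, half the available decay. -/
theorem toReal_spectralRadius_add_eq_zero {a b : B} (hb : (spectralRadius ℂ b).toReal = 0)
    (h : ∀ z : ℂ, ‖z‖ = 1 → ∃ K : ℝ, ∀ᶠ m : ℕ in atTop,
      (spectralRadius ℂ ((m : ℂ) • a + z • b)).toReal ≤ K) :
    (spectralRadius ℂ (a + b)).toReal = 0 := by
  refine le_antisymm (le_of_forall_pos_le_add fun δ' hδ' => ?_) ENNReal.toReal_nonneg
  rw [zero_add]
  set δ := δ' / 8 with hδdef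
  have hδ : 0 < δ := by positivity
  obtain ⟨r, hr0, hr1, C, hC, hsmall⟩ := exists_forall_norm_pow_le_mul_pow a hδ (hb ▸ hδ)
  -- `η = log 2 / (-2 log r)` makes the loss on the small circle a factor `2` per power
  obtain ⟨η, hη, hrη⟩ : ∃ η : ℝ, 0 < η ∧ r ^ (-(2 * η)) ≤ 2 := by
    refine ⟨log 2 / (2 * -log r), by
      have := log_neg hr0 hr1
      have := log_pos (one_lt_two)
      apply div_pos <;> linarith, ?_⟩
    have hlr := log_neg hr0 hr1
    rw [rpow_def_of_pos hr0]
    have : log r * -(2 * (log 2 / (2 * -log r))) = log 2 := by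
      have := hlr.ne
      field_simp
    rw [this, exp_log two_pos]
  have hdecay : ∀ᶠ m : ℕ in atTop, (m : ℝ) ^ (-η) < 2 * δ :=
    ((tendsto_rpow_neg_atTop hη).comp tendsto_natCast_atTop_atTop).eventually_lt_const
      (by positivity)
  obtain ⟨m, ⟨hm, hmδ⟩, hm2⟩ := (((eventually_circleAverage_posLog_norm_pow_le h hη).and hdecay).and
    (eventually_ge_atTop 2)).exists
  have hm1 : (1 : ℝ) ≤ m := by exact_mod_cast (by omega : 1 ≤ m)
  have hm0 : (0 : ℝ) < m := by linarith
  refine toReal_spectralRadius_le_of_eventually_norm_pow_le (C := max 1 C) (by positivity) hδ'.le ?_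
  filter_upwards [hm] with k hk
  obtain ⟨c, hc⟩ := exists_pow_smul_add_eq_sum a b k
  have hcj : ∀ j ∈ Finset.range (k + 1), ‖c j‖ ≤ max 1 C * (4 * δ) ^ k := by
    intro j hj
    have hjk : j ≤ k := by simp at hj; omega
    rcases le_or_gt (j : ℝ) (2 * η * k) with hjs | hjl
    · -- low-order coefficients: Cauchy estimate on the circle of radius `r`
      have h1 := norm_coeff_le_two_pow_mul_of_norm_le k (fun i => (r : ℂ) ^ i • c i)
        (M := C * δ ^ k) (by positivity) (fun ζ hζ => by
          have : ∑ i ∈ Finset.range (k + 1), ζ ^ i • (r : ℂ) ^ i • c i =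
              ((ζ * r) • a + b) ^ k := by
            rw [hc]
            refine Finset.sum_congr rfl fun i _ => by rw [smul_smul, mul_pow]
          rw [this]
          exact hsmall _ (by simp [hζ, abs_of_pos hr0]) k) hjk
      simp only [norm_smul, norm_pow, Complex.norm_real, norm_of_nonneg hr0.le] at h1
      have h2 : (r ^ j)⁻¹ ≤ 2 ^ k := by
        calc (r ^ j)⁻¹ = r ^ (-(j : ℝ)) := by rw [rpow_neg hr0.le, rpow_natCast]
          _ ≤ r ^ (-(2 * η) * k) :=
              rpow_le_rpow_of_exponent_ge hr0 hr1.le (by linarith)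
          _ = (r ^ (-(2 * η))) ^ k := by rw [rpow_mul_natCast hr0.le]
          _ ≤ 2 ^ k := by gcongr
      calc ‖c j‖ = (r ^ j)⁻¹ * (r ^ j * ‖c j‖) := by field_simp
        _ ≤ 2 ^ k * (2 ^ k * (C * δ ^ k)) := by gcongr
        _ = C * (4 * δ) ^ k := by
            rw [show (4 : ℝ) * δ = 2 * (2 * δ) by ring, mul_pow, mul_pow]; ring
        _ ≤ _ := by gcongr; exact le_max_right _ _
    · -- high-order coefficients: logarithmic mean over the circle of radius `m`
      have h1 := norm_coeff_le_two_pow_mul_exp_circleAverage k (fun i => (m : ℂ) ^ i • c i) hjk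
      have heq : ∀ ζ : ℂ, ∑ i ∈ Finset.range (k + 1), ζ ^ i • (m : ℂ) ^ i • c i =
          (ζ • (m : ℂ) • a + b) ^ k := by
        intro ζ
        rw [smul_smul, hc]
        refine Finset.sum_congr rfl fun i _ => by rw [smul_smul, mul_pow]
      simp only [heq, norm_smul, norm_pow, Complex.norm_natCast] at h1
      have h2 : exp (circleAverage (fun ζ => log⁺ ‖(ζ • (m : ℂ) • a + b) ^ k‖) 0 1) ≤
          (m : ℝ) ^ (η * k) := by
        rw [rpow_def_of_pos hm0, exp_le_exp]
        linarith
      have h3 : ((m : ℝ) ^ j)⁻¹ ≤ (m : ℝ) ^ (-(2 * η * k)) := by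
        calc ((m : ℝ) ^ j)⁻¹ = (m : ℝ) ^ (-(j : ℝ)) := by rw [rpow_neg hm0.le, rpow_natCast]
          _ ≤ _ := rpow_le_rpow_of_exponent_le hm1 (by linarith)
      calc ‖c j‖ = ((m : ℝ) ^ j)⁻¹ * ((m : ℝ) ^ j * ‖c j‖) := by field_simp
        _ ≤ (m : ℝ) ^ (-(2 * η * k)) * (2 ^ k * (m : ℝ) ^ (η * k)) := by
            refine mul_le_mul h3 (h1.trans ?_) (by positivity) (by positivity)
            gcongr
        _ = 2 ^ k * ((m : ℝ) ^ (-η)) ^ k := by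
            rw [← rpow_mul_natCast hm0.le, mul_left_comm, ← rpow_add hm0]
            congr 2; ring
        _ ≤ 2 ^ k * (2 * δ) ^ k := by gcongr
        _ = 1 * (4 * δ) ^ k := by rw [← mul_pow]; ring
        _ ≤ _ := by gcongr; exact le_max_left _ _
  have h1 := hc 1
  simp only [one_smul, one_pow] at h1
  rw [h1]
  calc ‖∑ i ∈ Finset.range (k + 1), c i‖ ≤ ∑ i ∈ Finset.range (k + 1), ‖c i‖ := norm_sum_le _ _
    _ ≤ ∑ _i ∈ Finset.range (k + 1), max 1 C * (4 * δ) ^ k := Finset.sum_le_sum hcj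
    _ = (k + 1) * (max 1 C * (4 * δ) ^ k) := by simp
    _ ≤ 2 ^ k * (max 1 C * (4 * δ) ^ k) := by
        gcongr
        exact_mod_cast Nat.lt_two_pow_self
    _ = max 1 C * δ' ^ k := by
        rw [show δ' = 2 * (4 * δ) by rw [hδdef]; ring, mul_pow 2 (4 * δ)]; ring

/-! ### A spectral characterization of the Jacobson radical -/

/-- Eigenvalues in a module belong to the spectrum. -/
theorem mem_spectrum_of_smul_eq {B X : Type*} [Ring B] [Algebra ℂ B] [AddCommGroup X] [Module B X]
    {a : B} {z : ℂ} {ξ : X} (hξ : ξ ≠ 0) (h : a • ξ = algebraMap ℂ B z • ξ) :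
    z ∈ spectrum ℂ a := by
  rw [spectrum.mem_iff]
  rintro ⟨u, hu⟩
  refine hξ ?_
  have h0 : (u : B) • ξ = 0 := by rw [hu, sub_smul, h, sub_self]
  rw [← one_smul B ξ, ← u.inv_mul, mul_smul, h0, smul_zero]

/-- The condition `1 - q ∈ L` says that the generator of the simple module `B ⧸ L` is fixed by `q`. -/
theorem exists_isMaximal_of_notMem_jacobson {B : Type*} [Ring B] {n q : B} (hn : n * q = n)
    (h : n ∉ Ring.jacobson B) (hq : IsIdempotentElem q) :
    ∃ L : Ideal B, L.IsMaximal ∧ n ∉ L ∧ 1 - q ∈ L := by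
  rw [Ring.jacobson_eq_sInf_isMaximal, Submodule.mem_sInf] at h
  push Not at h
  obtain ⟨(L : Ideal B), (hL : L.IsMaximal), hnL⟩ := h
  have hsimple : IsSimpleModule B (B ⧸ L) :=
    isSimpleModule_iff_isCoatom.mpr hL.out
  set φ := LinearMap.toSpanSingleton B (B ⧸ L) (Submodule.Quotient.mk q) with hφ
  have hφn : φ n = Submodule.Quotient.mk n := by
    rw [hφ, LinearMap.toSpanSingleton_apply, ← Submodule.Quotient.mk_smul, smul_eq_mul, hn]
  have hne : (Submodule.Quotient.mk n : B ⧸ L) ≠ 0 := by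
    rwa [Ne, Submodule.Quotient.mk_eq_zero]
  have hsurj : Function.Surjective φ := by
    refine (LinearMap.surjective_or_eq_zero φ).resolve_right fun h0 => hne ?_
    rw [← hφn, h0, LinearMap.zero_apply]
  have hker : IsSimpleModule B (B ⧸ LinearMap.ker φ) :=
    IsSimpleModule.congr (φ.quotKerEquivOfSurjective hsurj)
  refine ⟨(LinearMap.ker φ : Ideal B), ⟨isSimpleModule_iff_isCoatom.mp hker⟩, ?_, ?_⟩
  · rwa [LinearMap.mem_ker, hφn]
  · rw [LinearMap.mem_ker, hφ, LinearMap.toSpanSingleton_apply, ← Submodule.Quotient.mk_smul,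
      smul_eq_mul, sub_mul, one_mul, hq.eq, sub_self, Submodule.Quotient.mk_zero]

/-- Schur's lemma for the simple module `B ⧸ L`. Right multiplication by `n` induces a module
endomorphism of `B ⧸ L`, which is bounded for the quotient norm, so it has a spectral value `z`;
by simplicity it equals multiplication by `z`. -/
theorem exists_sub_algebraMap_mem_of_isMaximal {L : Ideal B} (hL : L.IsMaximal) {n : B}
    (h : ∀ b ∈ L, b * n ∈ L) : ∃ z : ℂ, n - algebraMap ℂ B z ∈ L := by
  have hsimple : IsSimpleModule B (B ⧸ L) := isSimpleModule_iff_isCoatom.mpr hL.out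
  have hnt : Nontrivial (B ⧸ L) := IsSimpleModule.nontrivial B _
  have hz : ∀ z : ℂ, L ≤ Submodule.comap
      (LinearMap.toSpanSingleton B B (n - algebraMap ℂ B z)) L := by
    intro z b hb
    rw [Submodule.mem_comap, LinearMap.toSpanSingleton_apply, smul_eq_mul, mul_sub,
      ← Algebra.commutes]
    exact L.sub_mem (h b hb) (L.mul_mem_left _ hb)
  let d : ℂ → (B ⧸ L) →ₗ[B] (B ⧸ L) := fun z => Submodule.mapQ L L _ (hz z)
  have hd : ∀ z b, d z (Submodule.Quotient.mk b) =
      Submodule.Quotient.mk (b * (n - algebraMap ℂ B z)) := fun z b => rfl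
  have hbound : ∀ x : B ⧸ L, ‖d 0 x‖ ≤ ‖n‖ * ‖x‖ := by
    intro x
    refine le_of_forall_pos_le_add fun ε hε => ?_
    have hε' : 0 < ε / (‖n‖ + 1) := by positivity
    obtain ⟨b, rfl, hb⟩ := Submodule.Quotient.norm_mk_lt x hε'
    rw [hd, map_zero, sub_zero]
    refine (Submodule.Quotient.norm_mk_le _ _).trans ((norm_mul_le _ _).trans ?_)
    have h1 : ε / (‖n‖ + 1) * ‖n‖ ≤ ε := by
      rw [div_mul_eq_mul_div, div_le_iff₀ (by positivity)]
      nlinarith [norm_nonneg n]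
    nlinarith [norm_nonneg n]
  let D : (B ⧸ L) →L[ℂ] (B ⧸ L) := LinearMap.mkContinuous
    ((d 0).restrictScalars ℂ) ‖n‖ hbound
  obtain ⟨z, hzD⟩ := spectrum.nonempty D
  have hrel : ∀ x, (algebraMap ℂ ((B ⧸ L) →L[ℂ] (B ⧸ L)) z - D) x = -(d z x) := by
    intro x
    obtain ⟨b, rfl⟩ := Submodule.Quotient.mk_surjective L x
    have h1 : D (Submodule.Quotient.mk b) = Submodule.Quotient.mk (b * n) := by
      change d 0 (Submodule.Quotient.mk b) = _
      rw [hd, map_zero, sub_zero]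
    have h2 : algebraMap ℂ ((B ⧸ L) →L[ℂ] (B ⧸ L)) z (Submodule.Quotient.mk b) =
        Submodule.Quotient.mk (b * algebraMap ℂ B z) := by
      rw [Algebra.algebraMap_eq_smul_one, ← Algebra.commutes, ← Algebra.smul_def]
      rfl
    rw [sub_apply, h1, h2, hd, mul_sub, ← Submodule.Quotient.mk_sub,
      ← Submodule.Quotient.mk_neg, neg_sub]
  refine ⟨z, ?_⟩
  rcases LinearMap.bijective_or_eq_zero (d z) with hbij | h0
  · refine absurd ?_ (spectrum.mem_iff.mp hzD)
    rw [ContinuousLinearMap.isUnit_iff_bijective]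
    have : ⇑(algebraMap ℂ ((B ⧸ L) →L[ℂ] (B ⧸ L)) z - D) = Neg.neg ∘ d z := funext hrel
    rw [this]
    exact (Equiv.neg _).bijective.comp hbij
  · have h1 := hd z 1
    rw [h0, LinearMap.zero_apply, one_mul, eq_comm, Submodule.Quotient.mk_eq_zero] at h1
    exact h1

/-- Zemánek's characterization of the radical, relative to the corner `q B q`: if adding `n` preserves
quasinilpotence in the corner, then `n` is in the radical. Otherwise `n` moves the cyclic vector `ξ`
of a simple module to a vector outside `ℂ ξ`, and a conjugate `g n g⁻¹` by a small perturbation `g`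
of `1` differs from `n` by an element with a nonzero eigenvalue at `ξ`. -/
theorem mem_jacobson_of_forall_toReal_spectralRadius_add_eq_zero {n q : B}
    (hq : IsIdempotentElem q) (hqn : q * n = n) (hnq : n * q = n)
    (hn : (spectralRadius ℂ n).toReal = 0)
    (h : ∀ y : B, q * y = y → y * q = y → (spectralRadius ℂ y).toReal = 0 →
      (spectralRadius ℂ (n + y)).toReal = 0) :
    n ∈ Ring.jacobson B := by
  by_contra hnJ
  obtain ⟨L, hL, hnL, hqL⟩ := exists_isMaximal_of_notMem_jacobson hnq hnJ hq
  have hsimple : IsSimpleModule B (B ⧸ L) := isSimpleModule_iff_isCoatom.mpr hL.out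
  set ξ : B ⧸ L := Submodule.Quotient.mk 1 with hξdef
  have hmk : ∀ b : B, (Submodule.Quotient.mk b : B ⧸ L) = b • ξ := by
    intro b
    rw [hξdef, ← Submodule.Quotient.mk_smul, smul_eq_mul, mul_one]
  have hmem : ∀ b : B, b • ξ = 0 ↔ b ∈ L := by
    intro b
    rw [← hmk, Submodule.Quotient.mk_eq_zero]
  have hξ : ξ ≠ 0 := fun h0 => hnL ((hmem n).mp (by rw [h0, smul_zero]))
  have hqξ : q • ξ = ξ := by
    have h1 := (hmem _).mpr hqL
    rw [sub_smul, one_smul, sub_eq_zero] at h1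
    exact h1.symm
  -- If the annihilator of `ξ` kills `n • ξ`, then `n • ξ` is a multiple of `ξ`, hence `0`.
  by_cases hcase : ∀ b ∈ L, b * n ∈ L
  · obtain ⟨z, hz⟩ := exists_sub_algebraMap_mem_of_isMaximal hL hcase
    have h1 := (hmem _).mpr hz
    rw [sub_smul, sub_eq_zero] at h1
    have hz0 : z = 0 := by
      have := norm_le_toReal_spectralRadius (mem_spectrum_of_smul_eq hξ h1)
      rw [hn] at this
      exact norm_le_zero_iff.mp this
    rw [hz0, map_zero, sub_zero] at hz
    exact hnL hz
  push Not at hcase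
  obtain ⟨b, hbL, hbn⟩ := hcase
  obtain ⟨c, hc⟩ : ∃ c : B, c • (b * n) • ξ = ξ := by
    have := IsSimpleModule.toSpanSingleton_surjective B (m := (b * n) • ξ)
      (fun h0 => hbn ((hmem _).mp h0))
    exact this ξ
  -- `w` sends `ξ` to `0` and `n • ξ` to `ξ`
  set w := q * c * b * q with hw
  have hwξ : w • ξ = 0 := by
    rw [hw, mul_smul, hqξ, mul_smul, (hmem b).mpr hbL, smul_zero]
  have hwn : w • n • ξ = ξ := by
    have h1 : w * n = q * (c * (b * n)) := by
      rw [hw, mul_assoc, hqn]; simp only [mul_assoc]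
    rw [← mul_smul, h1, mul_smul, mul_smul, hc, hqξ]
  have hqw : q * w = w := by rw [hw]; simp only [← mul_assoc]; rw [hq.eq]
  have hwq : w * q = w := by rw [hw, mul_assoc, hq.eq]
  obtain ⟨t, ht0, ht⟩ : ∃ t : ℂ, t ≠ 0 ∧ ‖-(t • w)‖ < 1 := by
    refine ⟨((‖w‖ + 1)⁻¹ : ℝ), by
      rw [Complex.ofReal_ne_zero]; positivity, ?_⟩
    rw [norm_neg, norm_smul, Complex.norm_real, norm_inv, norm_of_nonneg (by positivity),
      inv_mul_lt_iff₀ (by positivity)]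
    linarith
  set g : Bˣ := Units.oneSub (-(t • w)) ht with hgdef
  have hg : (g : B) = 1 + t • w := by rw [hgdef, Units.val_oneSub, sub_neg_eq_add]
  have hgq : (g : B) * q = q * g := by
    rw [hg, add_mul, mul_add, smul_mul_assoc, mul_smul_comm, hwq, hqw, one_mul, mul_one]
  have hgq' : (↑g⁻¹ : B) * q = q * ↑g⁻¹ := by
    have hcom : Commute (g : B) q := hgq
    exact (hcom.units_inv_left).eq
  set y : B := -(↑g * n * ↑g⁻¹) with hy
  have hyr : (spectralRadius ℂ y).toReal = 0 := by
    have h1 : spectrum ℂ (↑g * n * ↑g⁻¹) = spectrum ℂ n := spectrum.units_conjugate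
    have h2 : y = (-1 : ℂ) • (↑g * n * ↑g⁻¹) := by rw [neg_one_smul]
    rw [h2, toReal_spectralRadius_smul_of_norm_eq_one (by simp)]
    rw [← hn]
    simp only [spectralRadius, h1]
  have hqy : q * y = y := by
    rw [hy, mul_neg, ← mul_assoc, ← mul_assoc, ← hgq, mul_assoc (g : B) q n, hqn]
  have hyq : y * q = y := by
    rw [hy, neg_mul, mul_assoc, hgq', ← mul_assoc, mul_assoc (g : B) n q, hnq]
  have hgξ : (g : B) • ξ = ξ := by
    rw [hg, add_smul, one_smul, ← algebraMap_smul B t w, smul_assoc, hwξ, smul_zero, add_zero]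
  have hgξ' : (↑g⁻¹ : B) • ξ = ξ := by
    conv_lhs => rw [← hgξ]
    rw [← mul_smul, g.inv_mul, one_smul]
  have hfinal : (n + y) • ξ = algebraMap ℂ B (-t) • ξ := by
    rw [hy, add_smul, neg_smul, mul_smul, mul_smul, hgξ', hg, add_smul, one_smul,
      ← algebraMap_smul B t w, smul_assoc, hwn, map_neg, neg_smul]
    abel
  have := norm_le_toReal_spectralRadius (mem_spectrum_of_smul_eq hξ hfinal)
  rw [h y hqy hyq hyr, norm_neg] at this
  exact ht0 (norm_le_zero_iff.mp this)

/-- In a semisimple Banach algebra only `0` can be added to every element without changing spectra. -/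
theorem eq_zero_of_forall_spectrum_add_eq (hB : Ring.jacobson B = ⊥) {n : B}
    (h : ∀ y : B, spectrum ℂ (n + y) = spectrum ℂ y) : n = 0 := by
  have hr : ∀ y, spectralRadius ℂ (n + y) = spectralRadius ℂ y := fun y => by
    simp only [spectralRadius, h]
  have hn : (spectralRadius ℂ n).toReal = 0 := by
    have h1 := hr 0
    rw [add_zero, spectrum.spectralRadius_zero] at h1
    simp [h1]
  have h1 : n ∈ Ring.jacobson B :=
    mem_jacobson_of_forall_toReal_spectralRadius_add_eq_zero (q := 1) IsIdempotentElem.one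
      (one_mul n) (mul_one n) hn fun y _ _ hy => by rw [hr, hy]
  rwa [hB, Submodule.mem_bot] at h1

/-! ### Idempotents near elements with spectrum `{0, 1}` -/

theorem toReal_spectralRadius_mul_eq_zero {a b : B} (hab : Commute a b)
    (ha : (spectralRadius ℂ a).toReal = 0) : (spectralRadius ℂ (a * b)).toReal = 0 := by
  refine le_antisymm (le_of_forall_pos_le_add fun δ hδ => ?_) ENNReal.toReal_nonneg
  rw [zero_add]
  refine toReal_spectralRadius_le_of_eventually_norm_pow_le (C := ‖(1 : B)‖ + 1) (by positivity)
    hδ.le ?_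
  have hδ' : (spectralRadius ℂ a).toReal < δ / (‖b‖ + 1) := by rw [ha]; positivity
  filter_upwards [eventually_norm_pow_le_of_toReal_spectralRadius_lt hδ'] with k hk
  calc ‖(a * b) ^ k‖ = ‖a ^ k * b ^ k‖ := by rw [hab.mul_pow]
    _ ≤ ‖a ^ k‖ * ‖b ^ k‖ := norm_mul_le _ _
    _ ≤ (δ / (‖b‖ + 1)) ^ k * ((‖(1 : B)‖ + 1) * ‖b‖ ^ k) := by
        gcongr
        exact norm_pow_le_norm_one_add_one_mul b k
    _ ≤ (δ / (‖b‖ + 1)) ^ k * ((‖(1 : B)‖ + 1) * (‖b‖ + 1) ^ k) := by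
        gcongr; linarith
    _ = (‖(1 : B)‖ + 1) * δ ^ k := by
        rw [div_pow]; field_simp

theorem catalan_le_four_pow (k : ℕ) : catalan k ≤ 4 ^ k := by
  rw [catalan_eq_centralBinom_div]
  refine (Nat.div_le_self _ _).trans ((Nat.choose_le_two_pow _ _).trans ?_)
  rw [pow_mul]; norm_num

/-- The generating series of the Catalan numbers converges at a quasinilpotent `u`. -/
theorem exists_eq_one_add_mul_sq_of_toReal_spectralRadius_eq_zero {u : B}
    (hu : (spectralRadius ℂ u).toReal = 0) :
    ∃ c : B, c = 1 + u * (c * c) ∧ ∀ x, Commute x u → Commute x c := by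
  have hsum : Summable fun k : ℕ => ‖(catalan k : B) * u ^ k‖ := by
    have h8 : (spectralRadius ℂ u).toReal < 1 / 8 := by rw [hu]; norm_num
    have hg : Summable fun k : ℕ => (‖(1 : B)‖) * (1 / 2 : ℝ) ^ k :=
      (summable_geometric_of_lt_one (by norm_num) (by norm_num)).mul_left _
    refine hg.of_norm_bounded_eventually_nat ?_
    filter_upwards [eventually_norm_pow_le_of_toReal_spectralRadius_lt h8] with k hk
    rw [norm_norm]
    calc ‖(catalan k : B) * u ^ k‖ ≤ ‖(catalan k : B)‖ * ‖u ^ k‖ := norm_mul_le _ _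
      _ ≤ ((catalan k : ℝ) * ‖(1 : B)‖) * (1 / 8) ^ k := by
          gcongr
          exact Nat.norm_cast_le _
      _ ≤ ((4 : ℝ) ^ k * ‖(1 : B)‖) * (1 / 8) ^ k := by
          gcongr
          exact_mod_cast catalan_le_four_pow k
      _ = ‖(1 : B)‖ * (1 / 2) ^ k := by
          rw [mul_right_comm, ← mul_pow]; norm_num [mul_comm]
  refine ⟨∑' k : ℕ, (catalan k : B) * u ^ k, ?_, fun x hx => ?_⟩
  · rw [tsum_mul_tsum_eq_tsum_sum_antidiagonal_of_summable_norm hsum hsum,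
      hsum.of_norm.tsum_eq_zero_add]
    have hterm : ∀ k : ℕ, ∑ p ∈ Finset.HasAntidiagonal.antidiagonal k,
        (catalan p.1 : B) * u ^ p.1 * ((catalan p.2 : B) * u ^ p.2) =
        (catalan (k + 1) : B) * u ^ k := by
      intro k
      rw [catalan_succ', Nat.cast_sum, Finset.sum_mul]
      refine Finset.sum_congr rfl fun p hp => ?_
      rw [Finset.HasAntidiagonal.mem_antidiagonal] at hp
      rw [← hp, pow_add, Nat.cast_mul, mul_assoc, mul_assoc,
        (Nat.cast_commute (catalan p.2) (u ^ p.1)).left_comm]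
    have hsum2 := summable_norm_sum_mul_antidiagonal_of_summable_norm hsum hsum
    rw [← hsum2.of_norm.tsum_mul_left]
    simp only [hterm, catalan_zero, Nat.cast_one, pow_zero, mul_one]
    congr 1
    refine tsum_congr fun k => ?_
    rw [pow_succ', (Nat.cast_commute (catalan (k + 1)) u).left_comm]
  · refine Commute.tsum_right _ fun k => ?_
    exact (Nat.commute_cast x _).mul_right (hx.pow_right k)

/-- Lifting of idempotents modulo quasinilpotents, a substitute for the Riesz projection. With `c` the
Catalan series at `u = f - f * f`, the element `s = 1 - 2 u c` is a square root of
`1 - 4 u = (2 f - 1) ^ 2`, and `p = (1 + (2 f - 1) s⁻¹) / 2`. -/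
theorem exists_isIdempotentElem_commute {f : B}
    (hf : (spectralRadius ℂ (f - f * f)).toReal = 0) :
    ∃ p : B, IsIdempotentElem p ∧ Commute f p ∧ (spectralRadius ℂ (f - p)).toReal = 0 := by
  set u := f - f * f with hu
  have hfu : Commute f u := (Commute.refl f).sub_right ((Commute.refl f).mul_right (Commute.refl f))
  obtain ⟨c, hc, hcomm⟩ := exists_eq_one_add_mul_sq_of_toReal_spectralRadius_eq_zero hf
  have huc := hcomm u (Commute.refl u)
  set s := 1 - 2 * (u * c) with hs
  have hss : s * s = 1 - 4 * u := by
    have h1 : s * s = 1 - 4 * (u * (c - (c * u) * c)) := by rw [hs]; noncomm_ring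
    rw [h1, ← huc.eq, mul_assoc]
    conv_lhs => enter [2, 2, 2, 1]; rw [hc]
    rw [add_sub_cancel_right, mul_one]
  have hww : (2 * f - 1) * (2 * f - 1) = 1 - 4 * u := by rw [hu]; noncomm_ring
  have hsu : IsUnit s := by
    have h1 : IsUnit (s * s) := by
      have h4 : (spectralRadius ℂ (u * 4)).toReal = 0 :=
        toReal_spectralRadius_mul_eq_zero (Commute.ofNat_right u 4) hf
      have h2 : (1 : ℂ) ∉ spectrum ℂ (u * 4) := fun h => by
        have := norm_le_toReal_spectralRadius h
        rw [h4] at this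
        norm_num at this
      rw [spectrum.notMem_iff, map_one] at h2
      rwa [hss, ← (Commute.ofNat_right u 4).eq]
    exact ((Commute.refl s).isUnit_mul_iff.mp h1).1
  obtain ⟨s', hs'⟩ := hsu
  set v : B := ↑s'⁻¹ with hv
  have hsv : s * v = 1 := by rw [← hs', hv, s'.mul_inv]
  have hcommv : ∀ x, Commute x u → Commute x v := fun x hx => by
    have h1 : Commute x s := (Commute.one_right x).sub_right
      ((Commute.ofNat_right x 2).mul_right (hx.mul_right (hcomm x hx)))
    rw [← hs'] at h1
    exact h1.units_inv_right
  set w := 2 * f - 1 with hw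
  have hwu : Commute w u :=
    ((Commute.ofNat_left 2 u).mul_left hfu).sub_left (Commute.one_left u)
  have hwv : Commute w v := hcommv w hwu
  have hwvwv : (w * v) * (w * v) = 1 := by
    calc (w * v) * (w * v) = (w * w) * (v * v) := by
          rw [mul_assoc, ← mul_assoc v w v, ← hwv.eq]; simp only [mul_assoc]
      _ = s * (s * v) * v := by rw [hww, ← hss]; simp only [mul_assoc]
      _ = 1 := by rw [hsv, mul_one, hsv]
  refine ⟨(1 / 2 : ℂ) • (1 + w * v), ?_, ?_, ?_⟩
  · rw [IsIdempotentElem, smul_mul_smul_comm]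
    have h1 : (1 + w * v) * (1 + w * v) = (2 : ℂ) • (1 + w * v) := by
      rw [mul_add, add_mul, add_mul, hwvwv, two_smul]; noncomm_ring
    rw [h1, smul_smul]; norm_num
  · refine Commute.smul_right ?_ _
    refine (Commute.one_right f).add_right (Commute.mul_right ?_ (hcommv f hfu))
    exact ((Commute.ofNat_right f 2).mul_right (Commute.refl f)).sub_right (Commute.one_right f)
  · have h1 : f - (1 / 2 : ℂ) • (1 + w * v) = u * (-(c * v * w)) := by
      have h2 : f = (1 / 2 : ℂ) • (1 + w) := by
        have : (1 : B) + w = (2 : ℂ) • f := by rw [hw, two_smul]; noncomm_ring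
        rw [this, smul_smul]; norm_num
      have h3 : 1 - v = (-2 : ℂ) • (u * c * v) := by
        calc 1 - v = (s - 1) * v := by rw [sub_mul, hsv, one_mul]
          _ = _ := by
            rw [hs, show (-2 : ℂ) • (u * c * v) = -((2 : ℂ) • (u * c * v)) from neg_smul _ _,
              two_smul]
            noncomm_ring
      calc f - (1 / 2 : ℂ) • (1 + w * v) = (1 / 2 : ℂ) • (1 + w) - (1 / 2 : ℂ) • (1 + w * v) := by
            rw [← h2]
        _ = (1 / 2 : ℂ) • ((1 - v) * w) := by
            rw [← smul_sub, add_sub_add_left_eq_sub, sub_mul 1 v w, one_mul, hwv.eq]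
        _ = -(u * c * v * w) := by
            rw [h3, smul_mul_assoc, smul_smul]; norm_num
        _ = _ := by simp only [mul_assoc, mul_neg]
    rw [h1]
    refine toReal_spectralRadius_mul_eq_zero ?_ hf
    exact ((huc.mul_right (hcommv u (Commute.refl u))).mul_right hwu.symm).neg_right

/-! ### Spectra of perturbed multiples of an idempotent -/

/-- The resolvent of `m • e` at `z` has norm `O(1 / dist(z, {0, m}))`, with a constant independent of
`m`. -/
theorem exists_norm_le_or_norm_sub_le_of_mem_spectrum {e : B} (he : IsIdempotentElem e) (x : B) :
    ∃ C : ℝ, ∀ m : ℕ, ∀ z ∈ spectrum ℂ (m • e + x), ‖z‖ ≤ C ∨ ‖z - m‖ ≤ C := by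
  set C := (‖1 - e‖ + ‖e‖) * ‖x‖ with hC
  have hC0 : 0 ≤ C := by positivity
  refine ⟨C, fun m z hz => ?_⟩
  by_contra! hcon
  obtain ⟨h1, h2⟩ := hcon
  have hz0 : z ≠ 0 := norm_pos_iff.mp (hC0.trans_lt h1)
  have hzm : z - m ≠ 0 := norm_pos_iff.mp (hC0.trans_lt h2)
  set R : B := z⁻¹ • (1 - e) + (z - m)⁻¹ • e with hR
  have hdecomp : algebraMap ℂ B z - m • e = z • (1 - e) + (z - m) • e := by
    rw [Algebra.algebraMap_eq_smul_one, sub_smul, smul_sub, Nat.cast_smul_eq_nsmul]; abel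
  have he' : (1 - e) * (1 - e) = 1 - e := he.one_sub.eq
  have hee' : e * (1 - e) = 0 := by rw [mul_sub, mul_one, he.eq, sub_self]
  have he'e : (1 - e) * e = 0 := by rw [sub_mul, one_mul, he.eq, sub_self]
  have hleft : (algebraMap ℂ B z - m • e) * R = 1 := by
    rw [hdecomp, hR, mul_add, add_mul, add_mul]
    simp only [smul_mul_smul_comm, he', hee', he'e, he.eq, smul_zero, mul_inv_cancel₀ hz0,
      mul_inv_cancel₀ hzm, one_smul]
    abel
  have hright : R * (algebraMap ℂ B z - m • e) = 1 := by
    rw [hdecomp, hR, mul_add, add_mul, add_mul]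
    simp only [smul_mul_smul_comm, he', hee', he'e, he.eq, smul_zero, inv_mul_cancel₀ hz0,
      inv_mul_cancel₀ hzm, one_smul]
    abel
  have hRx : ‖R * x‖ < 1 := by
    set d := min ‖z‖ ‖z - m‖ with hd
    have hdC : C < d := lt_min h1 h2
    have hd0 : 0 < d := hC0.trans_lt hdC
    have hRn : ‖R‖ ≤ d⁻¹ * (‖1 - e‖ + ‖e‖) := by
      refine (norm_add_le _ _).trans ?_
      rw [norm_smul, norm_smul, norm_inv, norm_inv, mul_add]
      gcongr
      · exact min_le_left _ _
      · exact min_le_right _ _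
    calc ‖R * x‖ ≤ ‖R‖ * ‖x‖ := norm_mul_le _ _
      _ ≤ d⁻¹ * (‖1 - e‖ + ‖e‖) * ‖x‖ := by gcongr
      _ = d⁻¹ * C := by rw [hC]; ring
      _ < 1 := by rwa [inv_mul_lt_iff₀ hd0, mul_one]
  refine absurd ?_ (spectrum.mem_iff.mp hz)
  have hprod : algebraMap ℂ B z - (m • e + x) =
      (algebraMap ℂ B z - m • e) * (1 - R * x) := by
    rw [mul_sub, mul_one, ← mul_assoc, hleft, one_mul, sub_add_eq_sub_sub]
  rw [hprod]
  exact IsUnit.mul ⟨⟨_, R, hleft, hright⟩, rfl⟩ (Units.oneSub _ hRx).isUnit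

/-- The nonzero spectrum of a diagonal block `q * F` lies in the spectrum of `F`. -/
theorem mem_spectrum_of_mem_spectrum_mul {B : Type*} [Ring B] [Algebra ℂ B] {q F N : B}
    (hq : IsIdempotentElem q) (hF : Commute q F) (hFN : q * F = N) {z : ℂ} (hz : z ≠ 0)
    (h : z ∈ spectrum ℂ N) : z ∈ spectrum ℂ F := by
  by_contra hzF
  rw [spectrum.notMem_iff] at hzF
  obtain ⟨s, hs⟩ := hzF
  refine absurd ?_ (spectrum.mem_iff.mp h)
  have hqs : Commute q s := by
    rw [hs]; exact Commute.sub_right (Algebra.commutes z q).symm hF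
  have hqs' : Commute q (↑s⁻¹ : B) := hqs.units_inv_right
  have hMq : (algebraMap ℂ B z - N) = s * q + z • (1 - q) := by
    rw [hs, sub_mul, ← hF.eq, hFN, ← Algebra.smul_def, smul_sub,
      Algebra.algebraMap_eq_smul_one]
    abel
  have hq'q : (1 - q) * q = 0 := by rw [sub_mul, one_mul, hq.eq, sub_self]
  have hqq' : q * (1 - q) = 0 := by rw [mul_sub, mul_one, hq.eq, sub_self]
  have hq' : (1 - q) * (1 - q) = 1 - q := hq.one_sub.eq
  refine ⟨⟨_, q * ↑s⁻¹ + z⁻¹ • (1 - q), ?_, ?_⟩, rfl⟩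
  · rw [hMq, add_mul, mul_add, mul_add]
    have h1 : (s : B) * q * (q * ↑s⁻¹) = q := by
      rw [mul_assoc, ← mul_assoc q, hq.eq, ← mul_assoc, ← hqs.eq, mul_assoc, s.mul_inv, mul_one]
    have h2 : (s : B) * q * (z⁻¹ • (1 - q)) = 0 := by
      rw [mul_smul_comm, mul_assoc, hqq', mul_zero, smul_zero]
    have h3 : z • (1 - q) * (q * (↑s⁻¹ : B)) = 0 := by
      rw [smul_mul_assoc, ← mul_assoc, hq'q, zero_mul, smul_zero]
    rw [h1, h2, h3, smul_mul_smul_comm, hq', mul_inv_cancel₀ hz, one_smul]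
    abel
  · rw [hMq, add_mul, mul_add, mul_add]
    have h1 : q * (↑s⁻¹ : B) * (s * q) = q := by
      rw [mul_assoc, s.inv_mul_cancel_left, hq.eq]
    have h2 : q * (↑s⁻¹ : B) * (z • (1 - q)) = 0 := by
      rw [hqs'.eq, mul_smul_comm, mul_assoc, hqq', mul_zero, smul_zero]
    have h3 : z⁻¹ • (1 - q) * ((s : B) * q) = 0 := by
      rw [← hqs.eq, smul_mul_assoc, ← mul_assoc, hq'q, zero_mul, smul_zero]
    rw [h1, h2, h3, smul_mul_smul_comm, hq', inv_mul_cancel₀ hz, one_smul]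
    abel

theorem eventually_toReal_spectralRadius_smul_add_le {n : B}
    (hn : (spectralRadius ℂ n).toReal = 0) (y : B) :
    ∀ᶠ m : ℕ in atTop, (spectralRadius ℂ ((m : ℂ) • n + y)).toReal ≤ m * (1 / 4) := by
  obtain ⟨r, hr0, -, C, hC, h⟩ := exists_forall_norm_pow_le_mul_pow y
    (δ := 1 / 4) (by norm_num) (b := n) (by rw [hn]; norm_num)
  filter_upwards [tendsto_natCast_atTop_atTop.eventually_ge_atTop r⁻¹,
    eventually_ne_atTop 0] with m hm hm0
  have hmC : (m : ℂ) ≠ 0 := by exact_mod_cast hm0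
  refine toReal_spectralRadius_le_of_eventually_norm_pow_le hC (by positivity)
    (Eventually.of_forall fun k => ?_)
  have h1 : (m : ℂ) • n + y = (m : ℂ) • ((m : ℂ)⁻¹ • y + n) := by
    rw [smul_add, smul_smul, mul_inv_cancel₀ hmC, one_smul, add_comm]
  rw [h1, smul_pow, norm_smul, norm_pow (m : ℂ), Complex.norm_natCast, mul_pow, mul_left_comm]
  gcongr
  refine h _ ?_ k
  rw [norm_inv, Complex.norm_natCast]
  exact inv_le_of_inv_le₀ hr0 hm

/-- If every perturbation of `m • f` has spectrum within bounded distance of `{0, m}`, then the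
quasinilpotent part of `f` at the spectral value `0` vanishes. The points near `m` are not in the
spectrum of the block, whose spectral radius is `o(m)`; hence that spectral radius is bounded in `m`. -/
theorem mul_one_sub_eq_zero_of_forall_spectrum (hB : Ring.jacobson B = ⊥) {f p : B}
    (hp : IsIdempotentElem p) (hfp : Commute f p)
    (hn : (spectralRadius ℂ (f * (1 - p))).toReal = 0)
    (h : ∀ y : B, ∃ C : ℝ, ∀ m : ℕ, ∀ z ∈ spectrum ℂ (m • f + y), ‖z‖ ≤ C ∨ ‖z - m‖ ≤ C) :
    f * (1 - p) = 0 := by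
  set q := 1 - p with hqdef
  have hq : IsIdempotentElem q := hp.one_sub
  have hfq : Commute f q := (Commute.one_right f).sub_right hfp
  have hqn : q * (f * q) = f * q := by rw [← mul_assoc, ← hfq.eq, mul_assoc, hq.eq]
  have hnq : f * q * q = f * q := by rw [mul_assoc, hq.eq]
  have key : f * q ∈ Ring.jacobson B := by
    refine mem_jacobson_of_forall_toReal_spectralRadius_add_eq_zero hq hqn hnq hn
      fun y hqy hyq hy => toReal_spectralRadius_add_eq_zero hy fun ζ _ => ?_
    obtain ⟨C, hC⟩ := h (ζ • y)
    refine ⟨max C 0, ?_⟩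
    filter_upwards [eventually_toReal_spectralRadius_smul_add_le hn (ζ • y),
      tendsto_natCast_atTop_atTop.eventually_gt_atTop (2 * max C 0)] with m hm hmC
    refine toReal_spectralRadius_le (le_max_right _ _) fun z hz => ?_
    rcases eq_or_ne z 0 with rfl | hz0
    · simp
    have hzF : z ∈ spectrum ℂ (m • f + ζ • y) := by
      refine mem_spectrum_of_mem_spectrum_mul hq ?_ ?_ hz0 hz
      · refine Commute.add_right (hfq.symm.smul_right m) (Commute.smul_right ?_ ζ)
        rw [commute_iff_eq, hqy, hyq]
      · rw [mul_add, mul_smul_comm, mul_smul_comm, hqy, ← hfq.eq, Nat.cast_smul_eq_nsmul]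
    rcases hC m z hzF with h1 | h1
    · exact h1.trans (le_max_left _ _)
    · have h2 : ‖z‖ ≤ m * (1 / 4) := (norm_le_toReal_spectralRadius hz).trans hm
      have h3 : (m : ℝ) ≤ ‖z - m‖ + ‖z‖ := by
        have := norm_sub_le z (z - m)
        rw [sub_sub_cancel, Complex.norm_natCast] at this
        linarith
      have h4 := le_max_left C 0
      have h5 := le_max_right C 0
      linarith
  rwa [hB, Submodule.mem_bot] at key

end

/-! ### Spectrum-preserving additive maps -/

/-- The noncommutative case; `Ring.jacobson` is defined by left ideals, so one-sided inverses have to be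
matched. -/
theorem isUnit_one_add_of_mem_jacobson {R : Type*} [Ring R] {r : R} (hr : r ∈ Ring.jacobson R) :
    IsUnit (1 + r) := by
  have hleft : ∀ x ∈ Ring.jacobson R, ∃ s : R, s * (1 + x) = 1 := by
    intro x hx
    rw [← Ideal.jacobson_bot] at hx
    obtain ⟨s, hs⟩ := Ideal.exists_mul_add_sub_mem_of_mem_jacobson x hx
    rw [Ideal.mem_bot, sub_eq_zero] at hs
    exact ⟨s, by rwa [add_comm]⟩
  obtain ⟨s, hs⟩ := hleft r hr
  obtain ⟨s', hs'⟩ := hleft (-(s * r)) (neg_mem (Ideal.mul_mem_left _ s hr))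
  -- `s = 1 - s * r` has the right inverse `1 + r` and the left inverse `s'`
  have h1 : 1 + -(s * r) = s := by rw [← hs]; noncomm_ring
  rw [h1] at hs'
  rw [left_inv_eq_right_inv hs' hs] at hs'
  exact ⟨⟨1 + r, s, hs', hs⟩, rfl⟩

theorem spectrum_add_eq_of_mem_jacobson {R : Type*} [Ring R] [Algebra ℂ R] {b : R}
    (hb : b ∈ Ring.jacobson R) (y : R) : spectrum ℂ (b + y) = spectrum ℂ y := by
  have key : ∀ c ∈ Ring.jacobson R, ∀ x : R, spectrum ℂ (c + x) ⊆ spectrum ℂ x := by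
    intro c hc x z hz
    by_contra hzx
    rw [spectrum.notMem_iff] at hzx
    obtain ⟨u, hu⟩ := hzx
    refine spectrum.mem_iff.mp hz ?_
    have h1 : algebraMap ℂ R z - (c + x) = u * (1 + -(↑u⁻¹ * c)) := by
      rw [mul_add, mul_one, mul_neg, u.mul_inv_cancel_left, hu]; abel
    rw [h1]
    exact u.isUnit.mul (isUnit_one_add_of_mem_jacobson (neg_mem (Ideal.mul_mem_left _ _ hc)))
  refine (key b hb y).antisymm ?_
  have := key (-b) (neg_mem hb) (b + y)
  rwa [neg_add_cancel_left] at this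

section
variable {A B : Type*} [NormedRing A] [NormedAlgebra ℂ A] [CompleteSpace A]
    [NormedRing B] [NormedAlgebra ℂ B]

theorem jacobson_eq_bot_of_spectrum_eq (hA : Ring.jacobson A = ⊥)
    (T : A →+ B) (hsurj : Function.Surjective T)
    (hspec : ∀ x : A, spectrum ℂ (T x) = spectrum ℂ x) : Ring.jacobson B = ⊥ := by
  rw [eq_bot_iff]
  intro b hb
  obtain ⟨x, rfl⟩ := hsurj b
  have hx : x = 0 := eq_zero_of_forall_spectrum_add_eq hA fun y => by
    rw [← hspec, map_add, spectrum_add_eq_of_mem_jacobson hb, hspec]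
  rw [hx, map_zero]
  exact Submodule.zero_mem _

end

/-- Adding `T 1` to an element of `B`, like adding `1`, shifts its spectrum by `1`. -/
theorem map_one_of_spectrum_eq {A B : Type*} [Ring A] [Algebra ℂ A]
    [NormedRing B] [NormedAlgebra ℂ B] [CompleteSpace B] (hB : Ring.jacobson B = ⊥)
    (T : A →+ B) (hsurj : Function.Surjective T)
    (hspec : ∀ x : A, spectrum ℂ (T x) = spectrum ℂ x) : T 1 = 1 := by
  rw [← sub_eq_zero]
  refine eq_zero_of_forall_spectrum_add_eq hB fun y => ?_
  obtain ⟨x, rfl⟩ := hsurj y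
  have h1 : T 1 - 1 + T x = T (1 + x) - algebraMap ℂ B 1 := by rw [map_add, (algebraMap ℂ B).map_one]; abel
  have h2 : (1 : A) + x = algebraMap ℂ A 1 + x := by rw [map_one]
  rw [h1, ← spectrum.sub_singleton_eq, hspec, h2, ← spectrum.singleton_add_eq, hspec]
  rw [Set.singleton_add, Set.sub_singleton, Set.image_image]
  simp

theorem proposition2p8 {A B : Type*}
    [NormedRing A] [NormedAlgebra ℂ A] [CompleteSpace A]
    [NormedRing B] [NormedAlgebra ℂ B] [CompleteSpace B]
    (hA : Ring.jacobson A = ⊥)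
    (T : A →+ B) (hsurj : Function.Surjective T)
    (hspec : ∀ x : A, spectrum ℂ (T x) = spectrum ℂ x)
    (e : A) (he : IsIdempotentElem e) :
    IsIdempotentElem (T e) := by
  have hB := jacobson_eq_bot_of_spectrum_eq hA T hsurj hspec
  have hT1 := map_one_of_spectrum_eq hB T hsurj hspec
  have hgrowth : ∀ e' : A, IsIdempotentElem e' → ∀ y : B, ∃ C : ℝ, ∀ m : ℕ,
      ∀ z ∈ spectrum ℂ (m • T e' + y), ‖z‖ ≤ C ∨ ‖z - m‖ ≤ C := by
    intro e' he' y
    obtain ⟨x, rfl⟩ := hsurj y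
    obtain ⟨C, hC⟩ := exists_norm_le_or_norm_sub_le_of_mem_spectrum he' x
    refine ⟨C, fun m z hz => hC m z ?_⟩
    rwa [← map_nsmul, ← map_add, hspec] at hz
  have hquasi : (spectralRadius ℂ (T e - T e * T e)).toReal = 0 := by
    refine le_antisymm (toReal_spectralRadius_le le_rfl fun z hz => ?_) ENNReal.toReal_nonneg
    have h1 : T e - T e * T e = Polynomial.aeval (T e)
        (Polynomial.X - Polynomial.X ^ 2 : Polynomial ℂ) := by
      simp [sq]
    have hdeg : (Polynomial.X - Polynomial.X ^ 2 : Polynomial ℂ).degree = 2 := by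
      compute_degree!
    rw [h1, spectrum.map_polynomial_aeval_of_degree_pos _ _ (by rw [hdeg]; norm_num), hspec] at hz
    obtain ⟨w, hw, rfl⟩ := hz
    rcases he.spectrum_subset ℂ hw with rfl | rfl <;> simp
  obtain ⟨p, hp, hcomm, hr⟩ := exists_isIdempotentElem_commute hquasi
  have hcp : Commute (T e - p) p := hcomm.sub_left (Commute.refl p)
  have h1 : T e * (1 - p) = 0 := by
    refine mul_one_sub_eq_zero_of_forall_spectrum hB hp hcomm ?_ (hgrowth e he)
    have h2 : T e * (1 - p) = (T e - p) * (1 - p) := by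
      rw [sub_mul, mul_sub p, hp.eq, mul_one, sub_self, sub_zero]
    rw [h2]
    exact toReal_spectralRadius_mul_eq_zero ((Commute.one_right _).sub_right hcp) hr
  have h2 : T (1 - e) * (1 - (1 - p)) = 0 := by
    have hTe : T (1 - e) = 1 - T e := by rw [map_sub, hT1]
    refine mul_one_sub_eq_zero_of_forall_spectrum hB hp.one_sub ?_ ?_ (hgrowth _ he.one_sub)
    · rw [hTe]
      exact (Commute.one_right _).sub_right ((Commute.one_left p).sub_left hcomm)
    · have h3 : T (1 - e) * (1 - (1 - p)) = (T e - p) * -p := by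
        rw [hTe, sub_sub_cancel, mul_neg, sub_mul, sub_mul, hp.eq, one_mul, neg_sub]
      rw [h3]
      exact toReal_spectralRadius_mul_eq_zero hcp.neg_right hr
  have h3 : T e = p := by
    rw [map_sub, hT1, sub_sub_cancel, sub_mul, one_mul, sub_eq_zero] at h2
    rw [mul_sub, mul_one, sub_eq_zero] at h1
    rw [h1, ← h2]
  rw [h3]
  exact hp
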